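/- Let $\mathcal D[t]$ be a reflexive (complex) Fréchet space and let $\mathcal D^\times$ be its conjugate dual, i.e. the space of continuous conjugate linear functionals on $\mathcal D[t]$, with the strong dual topology $t^\times$, given by the seminorms $q_{\mathcal M}(F)=\sup_{g\in\mathcal M}|\langle F|g\rangle|$, $\mathcal M\subset\mathcal D$ bounded. Write $\langle g|F\rangle=\overline{\langle F|g\rangle}$. Let $(X,\mu)$ be a measure space and let $\omega,\theta:X\to\mathcal D^\times$ be weakly measurable, that is, $x\mapsto\langle g|\omega_x\rangle$ and $x\mapsto\langle g|\theta_x\rangle$ are $\mu$-measurable for every $g\in\mathcal D$. Assume that $\omega$ and $\theta$ are - total: $f\in\mathcal D$ and $\langle f|\omega_x\rangle=0$ for a.e. $x$ imply $f=0$, and - $\mu$-independent: if $\xi$ is measurable and, for every $g\in\mathcal D$, $\int_X\xi(x)\langle g|\omega_x\rangle\,d\mu$ exists and is $0$, then $\xi=0$ a.e. (and likewise for $\theta$). Let $V_\omega$ be the space of measurable functions $\xi:X\to\mathbb C$ (modulo equality a.e.) such that $\int_X\xi(x)\langle\omega_x|g\rangle\,d\mu$ exists for every $g\in\mathcal D$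 and defines a continuous conjugate linear functional $T_\omega\xi\in\mathcal D^\times$ of $g$; let $V_\omega$ and $W_\omega=V_\omega/\operatorname{Ker}T_\omega$ carry the topology given by the seminorms $p_{\mathcal M}(\xi)=q_{\mathcal M}(T_\omega\xi)$, $\mathcal M\subset\mathcal D$ bounded (by $\mu$-independence, $W_\omega=V_\omega$). Define $V_\theta$, $W_\theta$ in the same way. Assume that $V_\omega$ is complete. Let $$\Omega_{\theta,\omega}(f,g)=\int_X\langle f|\theta_x\rangle\langle\omega_x|g\rangle\,d\mu,\qquad f,g\in\mathcal D .$$ Then the following are equivalent. (i) $(\omega,\theta)$ is a compatible pair: $\Omega_{\theta,\omega}$ is well defined on $\mathcal D\times\mathcal D$ (the integral exists for all $f,g$) and jointly continuous, and $W_\omega$, $W_\theta$ are in conjugate duality with respect to the $L^2$ inner product. The latter means that $\int_X\xi\,\overline{\eta}\,d\mu$ exists for all $\xi\in V_\omega$, $\eta\in V_\theta$ and depends only on the classes of $\xi$ in $W_\omega$ and of $\eta$ in $W_\theta$, that $\overline\eta\mapsto\int_X(\cdot)\,\overline{\eta}\,d\mu$ is a topological isomorphism of the complex conjugate space $\overline{W}_\theta$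 onto the strong dual $W_\omega^*$, and that $\xi\mapsto\int_X\xi\,\overline{(\cdot)}\,d\mu$ is a topological isomorphism of $W_\omega$ onto the strong conjugate dual $W_\theta^\times$. (ii) $\Omega_{\theta,\omega}$ is well defined on $\mathcal D\times\mathcal D$ and jointly continuous, and the operator $S_{\theta,\omega}:\mathcal D\to\mathcal D^\times$ given by $\langle S_{\theta,\omega}f|g\rangle=\Omega_{\theta,\omega}(f,g)$ is a topological isomorphism of $\mathcal D[t]$ onto $\mathcal D^\times[t^\times]$. -/

import Mathlib

open MeasureTheory ComplexConjugate

noncomputable section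

namespace DistributionPairs

section Duals

variable (E : Type*) [AddCommGroup E] [Module ℂ E] [TopologicalSpace E]

/-- The conjugate dual `E^×`: all continuous conjugate linear functionals on `E`. Mathlib's
topology (and uniform structure) on this type is that of uniform convergence on the bounded subsets
of `E`, i.e. the strong dual topology `β(E^×, E)`, given by `q_M(F) = sup_{g ∈ M} |F g|`. -/
abbrev ConjDual : Type _ := E →L⋆[ℂ] ℂ

variable {E} in
/-- The canonical map of `E` into its strong conjugate bidual, `g ↦ (F ↦ conj (F g))`. -/
def toConjBidual [ContinuousSMul ℂ E] (g : E) : ConjDual (ConjDual E) where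
  toFun F := conj (F g)
  map_add' F G := by simp
  map_smul' c F := by simp
  cont := Complex.continuous_conj.comp (continuous_eval_const (F := ConjDual E) g)

/-- `E` is reflexive: the canonical map into the strong bidual is a topological isomorphism onto.
(It is linear, so this says that it is a homeomorphism. Composing functionals with complex
conjugation identifies linear with conjugate linear functionals, topologically, so that it does
not matter whether duals or conjugate duals are used.) -/
def IsReflexiveTVS [ContinuousSMul ℂ E] : Prop :=
  IsHomeomorph (toConjBidual : E → ConjDual (ConjDual E))

end Duals

variable {X : Type*} [MeasurableSpace X] (μ : Measure X)
variable {D : Type*} [AddCommGroup D] [Module ℂ D] [TopologicalSpace D]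

/-! For `ω : X → D^×`, the number `⟨ω_x|g⟩` is `ω x g`, and `⟨g|ω_x⟩` is `conj (ω x g)`. -/

/-- `ω` is weakly measurable: each `x ↦ ⟨g|ω_x⟩` is `μ`-measurable. -/
def WeaklyMeasurable (ω : X → ConjDual D) : Prop :=
  ∀ g : D, AEMeasurable (fun x => conj (ω x g)) μ

/-- `ω` is total: `⟨f|ω_x⟩ = 0` for almost every `x` implies `f = 0`. -/
def IsTotalMap (ω : X → ConjDual D) : Prop :=
  ∀ f : D, (∀ᵐ x ∂μ, conj (ω x f) = 0) → f = 0

/-- `ω` is `μ`-independent: a measurable function `ξ` such that the integral of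
`ξ(x) ⟨g|ω_x⟩` exists and is zero for every `g` is zero almost everywhere. -/
def IsMuIndependent (ω : X → ConjDual D) : Prop :=
  ∀ ξ : X → ℂ, Measurable ξ →
    (∀ g : D, Integrable (fun x => ξ x * conj (ω x g)) μ ∧ ∫ x, ξ x * conj (ω x g) ∂μ = 0) →
    ∀ᵐ x ∂μ, ξ x = 0

section Coefficient

variable (ω : X → ConjDual D)

/-- The coefficient space `V_ω`: measurable functions `ξ` modulo equality almost everywhere, such
that `F_ω(g) = ∫ ξ(x) ⟨ω_x|g⟩ dμ` exists for every `g` and depends continuously on `g` (it is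
automatically conjugate linear in `g`). -/
def coeff : Submodule ℂ (X →ₘ[μ] ℂ) where
  carrier := {ξ | (∀ g : D, Integrable (fun x => ξ x * ω x g) μ) ∧
    Continuous fun g : D => ∫ x, ξ x * ω x g ∂μ}
  zero_mem' := by
    have h : ∀ g : D, (fun x => (0 : X →ₘ[μ] ℂ) x * ω x g) =ᵐ[μ] fun _ => 0 := fun g => by
      filter_upwards [AEEqFun.coeFn_zero (α := X) (μ := μ) (β := ℂ)] with x hx
      simp [hx]
    refine ⟨fun g => (integrable_zero _ _ _).congr (h g).symm, ?_⟩
    simpa only [integral_congr_ae (h _), integral_zero] using continuous_const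
  add_mem' := by
    rintro ξ η ⟨hξ, hξ'⟩ ⟨hη, hη'⟩
    have h : ∀ g : D, (fun x => (ξ + η) x * ω x g) =ᵐ[μ]
        fun x => ξ x * ω x g + η x * ω x g := fun g => by
      filter_upwards [AEEqFun.coeFn_add ξ η] with x hx
      simp [hx, add_mul]
    refine ⟨fun g => ((hξ g).add (hη g)).congr (h g).symm, ?_⟩
    simpa only [integral_congr_ae (h _), integral_add (hξ _) (hη _)] using Continuous.fun_add hξ' hη'
  smul_mem' := by
    rintro c ξ ⟨hξ, hξ'⟩
    have h : ∀ g : D, (fun x => (c • ξ) x * ω x g) =ᵐ[μ]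
        fun x => c * (ξ x * ω x g) := fun g => by
      filter_upwards [AEEqFun.coeFn_smul c ξ] with x hx
      simp [hx, mul_assoc]
    refine ⟨fun g => ((hξ g).const_mul c).congr (h g).symm, ?_⟩
    simpa only [integral_congr_ae (h _), integral_const_mul] using Continuous.fun_mul continuous_const hξ'

/-- The type of elements of `V_ω`. -/
def V : Type _ := coeff μ ω

instance : AddCommGroup (V μ ω) := inferInstanceAs (AddCommGroup (coeff μ ω))
instance : Module ℂ (V μ ω) := inferInstanceAs (Module ℂ (coeff μ ω))

variable {μ ω} in
/-- The class modulo `μ`-null sets of functions that an element of `V_ω` is. -/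
def V.fn (ξ : V μ ω) : X →ₘ[μ] ℂ := Subtype.val (p := (· ∈ coeff μ ω)) ξ

variable {μ ω} in
lemma V.integrable (ξ : V μ ω) (g : D) : Integrable (fun x => ξ.fn x * ω x g) μ :=
  ξ.2.1 g

variable {μ ω} in
lemma V.continuous (ξ : V μ ω) : Continuous fun g : D => ∫ x, ξ.fn x * ω x g ∂μ :=
  ξ.2.2

/-- The synthesis operator `T_ω : V_ω → D^×`, `⟨T_ω ξ|g⟩ = ∫ ξ(x) ⟨ω_x|g⟩ dμ`. -/
def synthesis : V μ ω →ₗ[ℂ] ConjDual D where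
  toFun ξ :=
    { toFun := fun g => ∫ x, ξ.fn x * ω x g ∂μ
      map_add' := fun f g => by
        rw [← integral_add (ξ.integrable f) (ξ.integrable g)]
        simp [mul_add]
      map_smul' := fun c g => by
        rw [smul_eq_mul, ← integral_const_mul]
        simp [mul_left_comm]
      cont := ξ.continuous }
  map_add' ξ η := by
    ext g
    change ∫ x, (ξ.fn + η.fn) x * ω x g ∂μ = ∫ x, ξ.fn x * ω x g ∂μ + ∫ x, η.fn x * ω x g ∂μ
    rw [← integral_add (ξ.integrable g) (η.integrable g)]
    refine integral_congr_ae ?_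
    filter_upwards [AEEqFun.coeFn_add ξ.fn η.fn] with x hx
    simp [hx, add_mul]
  map_smul' c ξ := by
    ext g
    change ∫ x, (c • ξ.fn) x * ω x g ∂μ = c * ∫ x, ξ.fn x * ω x g ∂μ
    rw [← integral_const_mul]
    refine integral_congr_ae ?_
    filter_upwards [AEEqFun.coeFn_smul c ξ.fn] with x hx
    simp [hx, mul_assoc]

/-- The topology (and uniform structure) of `V_ω` is given by the seminorms
`p_M(ξ) = sup_{g ∈ M} |⟨g|T_ω ξ⟩| = q_M(T_ω ξ)`, for `M` bounded in `D`. -/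
instance : UniformSpace (V μ ω) := UniformSpace.comap (synthesis μ ω) inferInstance

/-- `W_ω = V_ω / Ker T_ω`. -/
def W : Type _ := V μ ω ⧸ LinearMap.ker (synthesis μ ω)

instance : AddCommGroup (W μ ω) :=
  inferInstanceAs (AddCommGroup (V μ ω ⧸ LinearMap.ker (synthesis μ ω)))
instance : Module ℂ (W μ ω) :=
  inferInstanceAs (Module ℂ (V μ ω ⧸ LinearMap.ker (synthesis μ ω)))

/-- The class `[ξ]_ω` in `W_ω`. -/
def cls : V μ ω →ₗ[ℂ] W μ ω := (LinearMap.ker (synthesis μ ω)).mkQ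

/-- The injective map `W_ω → D^×` that `T_ω` induces. -/
def synthesisQuot : W μ ω →ₗ[ℂ] ConjDual D :=
  (LinearMap.ker (synthesis μ ω)).liftQ (synthesis μ ω) le_rfl

/-- The topology `τ_ω` of `W_ω` is given by the seminorms
`p_M([ξ]_ω) = sup_{g ∈ M} |⟨g|T_ω ξ⟩| = q_M(T_ω ξ)`, for `M` bounded in `D`. -/
instance : UniformSpace (W μ ω) := UniformSpace.comap (synthesisQuot μ ω) inferInstance

end Coefficient

section Pairs

variable (θ ω : X → ConjDual D)

/-- `Ω_{θ,ω}(f, g) = ∫ ⟨f|θ_x⟩ ⟨ω_x|g⟩ dμ`. -/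
def pairForm (f g : D) : ℂ := ∫ x, conj (θ x f) * ω x g ∂μ

/-- `Ω_{θ,ω}` is well defined on `D × D` and jointly continuous. -/
structure FormAdmissible : Prop where
  integrable : ∀ f g : D, Integrable (fun x => conj (θ x f) * ω x g) μ
  continuous : Continuous fun p : D × D => pairForm μ θ ω p.1 p.2

variable {μ θ ω} in
/-- The operator `S_{θ,ω} : D → D^×`, `⟨S_{θ,ω} f|g⟩ = Ω_{θ,ω}(f, g)`. -/
def frameOp (h : FormAdmissible μ θ ω) : D →ₗ[ℂ] ConjDual D where
  toFun f :=
    { toFun := fun g => pairForm μ θ ω f g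
      map_add' := fun g g' => by
        simp only [pairForm]
        rw [← integral_add (h.integrable f g) (h.integrable f g')]
        simp [mul_add]
      map_smul' := fun c g => by
        simp only [pairForm]
        rw [smul_eq_mul, ← integral_const_mul]
        simp [mul_left_comm]
      cont := h.continuous.comp (continuous_const.prodMk continuous_id) }
  map_add' f f' := by
    ext g
    change pairForm μ θ ω (f + f') g = pairForm μ θ ω f g + pairForm μ θ ω f' g
    simp only [pairForm]
    rw [← integral_add (h.integrable f g) (h.integrable f' g)]
    simp [add_mul]
  map_smul' c f := by
    ext g
    change pairForm μ θ ω (c • f) g = c * pairForm μ θ ω f g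
    simp only [pairForm]
    rw [← integral_const_mul]
    simp [mul_assoc]

end Pairs

/-- `(ω, θ)` is a compatible pair: `Ω_{θ,ω}` is well defined on `D × D` and jointly continuous, and
the sesquilinear pairing `([ξ]_ω, [η]_θ) ↦ ∫ ξ conj(η) dμ` exists on `W_ω × W_θ` and puts the two
spaces in conjugate duality: it induces topological isomorphisms
* of the conjugate space of `W_θ` onto the strong dual `W_ω^*`, by `conj η ↦ ∫ (·) conj(η) dμ`
  (as a map on `W_θ` it is a conjugate linear isomorphism), and
* of `W_ω` onto the strong conjugate dual `W_θ^×`, by `ξ ↦ ∫ ξ conj(·) dμ`. -/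
structure IsCompatiblePair (ω θ : X → ConjDual D) : Prop where
  admissible : FormAdmissible μ θ ω
  integrable : ∀ (ξ : V μ ω) (η : V μ θ), Integrable (fun x => ξ.fn x * conj (η.fn x)) μ
  dual : ∃ Y : W μ θ ≃L⋆[ℂ] (W μ ω →L[ℂ] ℂ), ∀ (ξ : V μ ω) (η : V μ θ),
    Y (cls μ θ η) (cls μ ω ξ) = ∫ x, ξ.fn x * conj (η.fn x) ∂μ
  conjDual : ∃ Z : W μ ω ≃L[ℂ] ConjDual (W μ θ), ∀ (ξ : V μ ω) (η : V μ θ),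
    Z (cls μ ω ξ) (cls μ θ η) = ∫ x, ξ.fn x * conj (η.fn x) ∂μ


end DistributionPairs

end

open DistributionPairs MeasureTheory

/-!
Write `J : D → (D^×)^×` for the canonical map, an isomorphism by reflexivity, `T_ω`, `T_θ` for the
synthesis operators and `S` for the frame operator. The topology of `W_ω` is the one that makes
`T_ω : W_ω → D^×` an embedding, so `T_ω` is a topological isomorphism once it is onto. The functions
`x ↦ ⟨f|θ_x⟩` lie in `V_ω`, and `T_ω` maps them to `S f` (`synthesis_analysis`); moreover, their `L²`
pairing with `η ∈ V_θ` is `J f` evaluated at `T_θ η` (`integral_analysis_mul_conj`). The roles of `ω`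
and `θ` can be exchanged, which replaces `S` by its adjoint.

If the range of `T_ω` is closed, then `T_ω` is onto (`synthesis_surjective_of_isClosed`): a continuous
functional vanishing on the range is evaluation at some `g ∈ D`, by reflexivity, and it vanishes
on all `S f`, so that the adjoint of `S` kills `g`, and `g = 0` by independence and totality.

Let the pair be compatible. Completeness of `V_ω` makes `T_ω` an isomorphism. The first duality then
gives `W_θ ≃ W_ω^* ≃ (D^×)^* ≃ D` (up to conjugations), so `W_θ` is complete and `T_θ` is an
isomorphism as well. With the second duality `Z : W_ω ≃ W_θ^×`, the operator `S` is the composition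
of the isomorphisms `J`, the transpose of `T_θ`, `Z⁻¹` and `T_ω`.

Conversely, let `S` be an isomorphism. Then so is its adjoint, the composition of `J` with the
transpose of `S`. Hence `T_ω` and `T_θ` are onto, every element of `V_ω` is of the form
`x ↦ ⟨f|θ_x⟩` because `T_ω` is injective by independence, and the duality `Z` is the
composition of `T_ω`, `S⁻¹`, `J` and the transpose of `T_θ` (`exists_conjDual_equiv`). The
other duality is obtained by exchanging `ω` and `θ`.
-/

open MeasureTheory ComplexConjugate

noncomputable section

namespace DistributionPairs

/-! ### Reflexivity and separation -/

/-- A linear homeomorphism, as a continuous linear equivalence. -/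
def equivOfIsHomeomorph {E F : Type*} [AddCommGroup E] [Module ℂ E] [TopologicalSpace E]
    [AddCommGroup F] [Module ℂ F] [TopologicalSpace F] (f : E →ₗ[ℂ] F) (hf : IsHomeomorph f) :
    E ≃L[ℂ] F where
  toLinearEquiv := LinearEquiv.ofBijective f hf.bijective
  continuous_toFun := hf.continuous
  continuous_invFun := (hf.homeomorph f).symm.continuous.congr fun y =>
    (hf.homeomorph f).symm_apply_eq.2
      ((LinearEquiv.ofBijective f hf.bijective).apply_symm_apply y).symm

/-- In a locally convex space, a point outside a closed subspace is separated from it by a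
continuous linear functional vanishing on the subspace. -/
lemma exists_clm_eq_zero_of_notMem {E : Type*} [AddCommGroup E] [Module ℂ E] [TopologicalSpace E]
    [IsTopologicalAddGroup E] [ContinuousSMul ℂ E] [LocallyConvexSpace ℝ E]
    (S : Submodule ℂ E) (hS : IsClosed (S : Set E)) {x : E} (hx : x ∉ S) :
    ∃ φ : E →L[ℂ] ℂ, (∀ y ∈ S, φ y = 0) ∧ φ x ≠ 0 := by
  obtain ⟨φ, u, hu, hxu⟩ := RCLike.geometric_hahn_banach_closed_point (𝕜 := ℂ)
    ((S.restrictScalars ℝ).convex) hS hx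
  have hu0 : 0 < u := by simpa using hu 0 S.zero_mem
  refine ⟨φ, fun y hy => ?_, fun h => ?_⟩
  · by_contra hne
    -- the multiple of `y` at which `φ` takes the value `u` lies in `S`
    have := hu (((u : ℂ) * (φ y)⁻¹) • y) (S.smul_mem _ hy)
    simp [hne] at this
  · rw [h] at hxu
    simp at hxu
    exact lt_asymm hxu hu0

section Dual

variable {D : Type*} [AddCommGroup D] [Module ℂ D] [TopologicalSpace D] [ContinuousSMul ℂ D]

@[simp] lemma toConjBidual_apply (g : D) (F : ConjDual D) : toConjBidual g F = conj (F g) := rfl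

/-- The canonical map of a reflexive space onto its strong conjugate bidual. -/
def bidualEquiv (hD : IsReflexiveTVS D) : D ≃L[ℂ] ConjDual (ConjDual D) :=
  equivOfIsHomeomorph
    { toFun := toConjBidual
      map_add' := fun f g => by ext F; simp
      map_smul' := fun c g => by ext F; simp } hD

@[simp] lemma bidualEquiv_apply (hD : IsReflexiveTVS D) (g : D) (F : ConjDual D) :
    bidualEquiv hD g F = conj (F g) := rfl

/-- The topological isomorphism of strong conjugate duals induced by a topological isomorphism. -/
def conjDualCongr {E F : Type*} [AddCommGroup E] [Module ℂ E] [TopologicalSpace E]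
    [AddCommGroup F] [Module ℂ F] [TopologicalSpace F]
    (e : E ≃L[ℂ] F) : ConjDual F ≃L[ℂ] ConjDual E :=
  e.symm.arrowCongrSL (ContinuousLinearEquiv.refl ℂ ℂ)

@[simp] lemma conjDualCongr_apply {E F : Type*} [AddCommGroup E] [Module ℂ E] [TopologicalSpace E]
    [AddCommGroup F] [Module ℂ F] [TopologicalSpace F]
    (e : E ≃L[ℂ] F) (φ : ConjDual F) (x : E) : conjDualCongr e φ x = φ (e x) := rfl

/-- Complex conjugation of functionals, as a conjugate linear topological isomorphism of the strong
conjugate dual onto the strong dual. -/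
def conjDualConj (E : Type*) [AddCommGroup E] [Module ℂ E] [TopologicalSpace E] :
    ConjDual E ≃L⋆[ℂ] (E →L[ℂ] ℂ) :=
  (ContinuousLinearEquiv.refl ℂ E).arrowCongrSL (starL ℂ)

@[simp] lemma conjDualConj_apply {E : Type*} [AddCommGroup E] [Module ℂ E] [TopologicalSpace E]
    (φ : ConjDual E) (x : E) : conjDualConj E φ x = conj (φ x) := rfl

end Dual

variable {X : Type*} [MeasurableSpace X] {μ : Measure X}
variable {D : Type*} [AddCommGroup D] [Module ℂ D]

section Synthesis

variable [TopologicalSpace D] {ω θ : X → ConjDual D}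

/-! ### The synthesis operator -/

lemma synthesis_apply (ξ : V μ ω) (g : D) : synthesis μ ω ξ g = ∫ x, ξ.fn x * ω x g ∂μ := rfl

lemma cls_surjective : Function.Surjective (cls μ ω) := Submodule.mkQ_surjective _

lemma synthesisQuot_injective : Function.Injective (synthesisQuot μ ω) :=
  LinearMap.ker_eq_bot.1 (Submodule.ker_liftQ_eq_bot' _ _ rfl)

lemma range_synthesisQuot :
    LinearMap.range (synthesisQuot μ ω) = LinearMap.range (synthesis μ ω) :=
  Submodule.range_liftQ _ _ _

lemma isUniformInducing_synthesis : IsUniformInducing (synthesis μ ω) := ⟨rfl⟩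

lemma isUniformInducing_synthesisQuot : IsUniformInducing (synthesisQuot μ ω) := ⟨rfl⟩

instance : IsUniformAddGroup (W μ ω) := IsUniformAddGroup.comap (synthesisQuot μ ω)

/-- If the synthesis operator is onto, the induced map on `W_ω` is a topological isomorphism, because
`W_ω` carries the topology induced by it. -/
def synthesisEquiv (h : Function.Surjective (synthesis μ ω)) : W μ ω ≃L[ℂ] ConjDual D :=
  have hs : Function.Surjective (synthesisQuot μ ω) := by
    rw [← LinearMap.range_eq_top, range_synthesisQuot, LinearMap.range_eq_top.2 h]
  equivOfIsHomeomorph (synthesisQuot μ ω) <| isHomeomorph_iff_isEmbedding_surjective.2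
    ⟨⟨isUniformInducing_synthesisQuot.isInducing, synthesisQuot_injective⟩, hs⟩

@[simp] lemma synthesisEquiv_cls (h : Function.Surjective (synthesis μ ω)) (ξ : V μ ω) :
    synthesisEquiv h (cls μ ω ξ) = synthesis μ ω ξ := rfl

/-- `μ`-independence says that the synthesis operator is injective. -/
lemma IsMuIndependent.fn_ae_eq_zero (h : IsMuIndependent μ ω) {ξ : V μ ω}
    (hξ : synthesis μ ω ξ = 0) : ∀ᵐ x ∂μ, ξ.fn x = 0 := by
  have key : ∀ g x, conj (ξ.fn x) * conj (ω x g) = conj (ξ.fn x * ω x g) := by simp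
  have := h (fun x => conj (ξ.fn x)) (Complex.continuous_conj.measurable.comp
    ξ.fn.measurable) fun g => by
      simp only [key]
      refine ⟨Complex.conjCLE.toContinuousLinearMap.integrable_comp (ξ.integrable g), ?_⟩
      rw [integral_conj, ← synthesis_apply, hξ]
      simp
  simpa using this

lemma IsMuIndependent.synthesis_injective (h : IsMuIndependent μ ω) :
    Function.Injective (synthesis μ ω) := by
  rw [injective_iff_map_eq_zero]
  intro ξ hξ
  refine Subtype.ext (AEEqFun.ext ?_)
  filter_upwards [h.fn_ae_eq_zero hξ, AEEqFun.coeFn_zero (α := X) (μ := μ) (β := ℂ)] with x hx hx'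
  exact hx.trans hx'.symm

/-! ### Analysis functions of an admissible form -/

lemma FormAdmissible.symm (h : FormAdmissible μ θ ω) : FormAdmissible μ ω θ := by
  have key : ∀ f g x, conj (ω x f) * θ x g = conj (conj (θ x g) * ω x f) := fun f g x => by
    simp [mul_comm]
  refine ⟨fun f g => ?_, ?_⟩
  · simp only [key]
    exact Complex.conjCLE.toContinuousLinearMap.integrable_comp (h.integrable g f)
  · simp only [pairForm, key, integral_conj]
    exact Complex.continuous_conj.comp (h.continuous.comp continuous_swap)

/-- The function `x ↦ ⟨f|θ_x⟩`, as an element of `V_ω`. -/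
def analysis (h : FormAdmissible μ θ ω) (hθ : WeaklyMeasurable μ θ) (f : D) : V μ ω :=
  ⟨AEEqFun.mk (fun x => conj (θ x f)) (hθ f).aestronglyMeasurable, by
    have key : ∀ g : D, (fun x => conj (θ x f) * ω x g) =ᵐ[μ]
        fun x => AEEqFun.mk (fun x => conj (θ x f)) (hθ f).aestronglyMeasurable x * ω x g :=
      fun g => by
        filter_upwards [AEEqFun.coeFn_mk _ (hθ f).aestronglyMeasurable] with x hx
        rw [hx]
    refine ⟨fun g => (h.integrable f g).congr (key g), ?_⟩
    simp only [← integral_congr_ae (key _)]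
    exact h.continuous.comp (continuous_const.prodMk continuous_id)⟩

lemma analysis_fn_ae_eq (h : FormAdmissible μ θ ω) (hθ : WeaklyMeasurable μ θ) (f : D) :
    (analysis h hθ f).fn =ᵐ[μ] fun x => conj (θ x f) :=
  AEEqFun.coeFn_mk _ (hθ f).aestronglyMeasurable

/-- The frame operator factors through the synthesis operator. -/
lemma synthesis_analysis (h : FormAdmissible μ θ ω) (hθ : WeaklyMeasurable μ θ) (f : D) :
    synthesis μ ω (analysis h hθ f) = frameOp h f := by
  ext g
  refine integral_congr_ae ?_
  filter_upwards [analysis_fn_ae_eq h hθ f] with x hx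
  rw [hx]

/-- The two frame operators of a pair are adjoint to each other. -/
lemma frameOp_symm_apply (h : FormAdmissible μ θ ω) (f g : D) :
    frameOp h.symm g f = conj (frameOp h f g) := by
  change ∫ x, _ ∂μ = conj (∫ x, _ ∂μ)
  rw [← integral_conj]
  simp [mul_comm]

lemma analysis_mul_conj_ae_eq (h : FormAdmissible μ θ ω) (hθ : WeaklyMeasurable μ θ) (f : D)
    (η : V μ θ) : (fun x => conj (η.fn x * θ x f)) =ᵐ[μ]
      fun x => (analysis h hθ f).fn x * conj (η.fn x) := by
  filter_upwards [analysis_fn_ae_eq h hθ f] with x hx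
  rw [hx, map_mul, mul_comm]

lemma integrable_analysis_mul_conj (h : FormAdmissible μ θ ω) (hθ : WeaklyMeasurable μ θ) (f : D)
    (η : V μ θ) : Integrable (fun x => (analysis h hθ f).fn x * conj (η.fn x)) μ :=
  (Complex.conjCLE.toContinuousLinearMap.integrable_comp (η.integrable f)).congr
    (analysis_mul_conj_ae_eq h hθ f η)

/-- The `L²` pairing with an analysis function is evaluation of the synthesis operator. -/
lemma integral_analysis_mul_conj (h : FormAdmissible μ θ ω) (hθ : WeaklyMeasurable μ θ) (f : D)
    (η : V μ θ) :
    ∫ x, (analysis h hθ f).fn x * conj (η.fn x) ∂μ = conj (synthesis μ θ η f) := by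
  rw [← integral_congr_ae (analysis_mul_conj_ae_eq h hθ f η), integral_conj, synthesis_apply]

/-- `S f = 0` makes `x ↦ ⟨f|θ_x⟩` an element of the kernel of `T_ω`, so that independence of `ω` and
totality of `θ` apply. -/
lemma frameOp_injective (h : FormAdmissible μ θ ω) (hθ : WeaklyMeasurable μ θ)
    (hω_ind : IsMuIndependent μ ω) (hθ_tot : IsTotalMap μ θ) :
    Function.Injective (frameOp h) := by
  rw [injective_iff_map_eq_zero]
  intro f hf
  refine hθ_tot f ?_
  filter_upwards [hω_ind.fn_ae_eq_zero ((synthesis_analysis h hθ f).trans hf),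
    analysis_fn_ae_eq h hθ f] with x hx hx'
  exact hx'.symm.trans hx

end Synthesis

/-! ### Surjectivity of the synthesis operator -/

section Surjective

variable [TopologicalSpace D] [ContinuousSMul ℂ D] {ω θ : X → ConjDual D}

/-- The range of `T_ω` contains that of the frame operator, whose adjoint is injective by
independence of `θ` and totality of `ω`. By reflexivity, it is therefore dense. -/
lemma synthesis_surjective_of_isClosed (hD : IsReflexiveTVS D) (h : FormAdmissible μ θ ω)
    (hω : WeaklyMeasurable μ ω) (hθ : WeaklyMeasurable μ θ) (hθ_ind : IsMuIndependent μ θ)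
    (hω_tot : IsTotalMap μ ω)
    (hcl : IsClosed (LinearMap.range (synthesis μ ω) : Set (ConjDual D))) :
    Function.Surjective (synthesis μ ω) := by
  intro F
  by_contra hF
  obtain ⟨φ, hφ, hφF⟩ := exists_clm_eq_zero_of_notMem _ hcl hF
  obtain ⟨g, hg⟩ := (bidualEquiv hD).surjective ((conjDualConj _).symm φ)
  have hφg : ∀ G : ConjDual D, φ G = G g := fun G => by
    rw [← (conjDualConj (ConjDual D)).apply_symm_apply φ, ← hg]
    simp
  have : frameOp h.symm g = 0 := by
    ext f
    rw [frameOp_symm_apply h, ← hφg, ← synthesis_analysis h hθ, hφ _ (LinearMap.mem_range_self _ _)]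
    simp
  have hg0 : g = 0 := frameOp_injective h.symm hω hθ_ind hω_tot (by rw [this, map_zero])
  exact hφF (by rw [hφg, hg0, map_zero])

/-- Completeness makes the range of the synthesis operator closed. -/
lemma isClosed_range_synthesis [CompleteSpace (V μ ω)] :
    IsClosed (LinearMap.range (synthesis μ ω) : Set (ConjDual D)) := by
  rw [LinearMap.coe_range]
  exact (isUniformInducing_synthesis.isComplete_range).isClosed

lemma isClosed_range_synthesis_of_quot [CompleteSpace (W μ ω)] :
    IsClosed (LinearMap.range (synthesis μ ω) : Set (ConjDual D)) := by
  rw [← range_synthesisQuot, LinearMap.coe_range]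
  exact (isUniformInducing_synthesisQuot.isComplete_range).isClosed

end Surjective

/-! ### Compatible pairs and the frame operator -/

section Pairs

variable [TopologicalSpace D] [ContinuousSMul ℂ D] {ω θ : X → ConjDual D}

/-- If the frame operator is an isomorphism, it identifies `W_ω ≃ D^×` with `D`, and thus with the
conjugate dual of `D^× ≃ W_θ`. -/
lemma exists_conjDual_equiv (hD : IsReflexiveTVS D) (h : FormAdmissible μ θ ω)
    (hθ : WeaklyMeasurable μ θ) (hω_ind : IsMuIndependent μ ω)
    (S : D ≃L[ℂ] ConjDual D) (hS : ∀ f, S f = frameOp h f)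
    (hω_surj : Function.Surjective (synthesis μ ω))
    (hθ_surj : Function.Surjective (synthesis μ θ)) :
    (∀ (ξ : V μ ω) (η : V μ θ), Integrable (fun x => ξ.fn x * conj (η.fn x)) μ) ∧
    ∃ Z : W μ ω ≃L[ℂ] ConjDual (W μ θ), ∀ (ξ : V μ ω) (η : V μ θ),
      Z (cls μ ω ξ) (cls μ θ η) = ∫ x, ξ.fn x * conj (η.fn x) ∂μ := by
  have hξ : ∀ ξ : V μ ω, ∃ f, ξ = analysis h hθ f := fun ξ => by
    obtain ⟨f, hf⟩ := S.surjective (synthesis μ ω ξ)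
    exact ⟨f, hω_ind.synthesis_injective (by rw [← hf, synthesis_analysis, hS])⟩
  refine ⟨fun ξ η => ?_, (synthesisEquiv hω_surj).trans <| S.symm.trans <| (bidualEquiv hD).trans <|
    conjDualCongr (synthesisEquiv hθ_surj), fun ξ η => ?_⟩
  · obtain ⟨f, rfl⟩ := hξ ξ
    exact integrable_analysis_mul_conj h hθ f η
  · obtain ⟨f, rfl⟩ := hξ ξ
    simp [integral_analysis_mul_conj, synthesis_analysis, ← hS]

lemma isCompatiblePair_of_isHomeomorph_frameOp
    (hD : IsReflexiveTVS D) (hω : WeaklyMeasurable μ ω) (hθ : WeaklyMeasurable μ θ)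
    (hω_ind : IsMuIndependent μ ω) (hθ_ind : IsMuIndependent μ θ)
    (h : FormAdmissible μ θ ω) (hS : IsHomeomorph (frameOp h : D → ConjDual D)) :
    IsCompatiblePair μ ω θ := by
  let S : D ≃L[ℂ] ConjDual D := equivOfIsHomeomorph (frameOp h) hS
  have hS : ∀ f, S f = frameOp h f := fun _ => rfl
  -- the adjoint of `S` is the frame operator of the pair with the roles of `ω` and `θ` exchanged
  let S' : D ≃L[ℂ] ConjDual D := (bidualEquiv hD).trans (conjDualCongr S)
  have hS' : ∀ g, S' g = frameOp h.symm g := fun g => by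
    ext f
    simp [S', frameOp_symm_apply h, hS]
  have hω_surj : Function.Surjective (synthesis μ ω) := fun F =>
    ⟨analysis h hθ (S.symm F), by rw [synthesis_analysis, ← hS, S.apply_symm_apply]⟩
  have hθ_surj : Function.Surjective (synthesis μ θ) := fun F =>
    ⟨analysis h.symm hω (S'.symm F), by rw [synthesis_analysis, ← hS', S'.apply_symm_apply]⟩
  obtain ⟨hint, hZ⟩ := exists_conjDual_equiv hD h hθ hω_ind S hS hω_surj hθ_surj
  obtain ⟨-, Z', hZ'⟩ := exists_conjDual_equiv hD h.symm hω hθ_ind S' hS' hθ_surj hω_surj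
  refine ⟨h, hint, ⟨Z'.trans (conjDualConj _), fun ξ η => ?_⟩, hZ⟩
  rw [ContinuousLinearEquiv.trans_apply, conjDualConj_apply, hZ', ← integral_conj]
  simp [mul_comm]

end Pairs

section Complete

variable [UniformSpace D] [IsUniformAddGroup D] [CompleteSpace D] [ContinuousSMul ℂ D]
  {ω θ : X → ConjDual D}

/-- In a compatible pair, `W_θ` is isomorphic to the dual of `W_ω ≃ D^×`, hence to `D`, and so
inherits its completeness. -/
lemma IsCompatiblePair.completeSpace_W (hD : IsReflexiveTVS D)
    (h : IsCompatiblePair μ ω θ) (hω : Function.Surjective (synthesis μ ω)) :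
    CompleteSpace (W μ θ) := by
  obtain ⟨Y, -⟩ := h.dual
  let e : D ≃L[ℂ] W μ θ := (bidualEquiv hD).trans <| (conjDualCongr (synthesisEquiv hω)).trans <|
    (conjDualConj (W μ ω)).trans Y.symm
  exact (completeSpace_congr (e := e.toEquiv) e.isUniformEmbedding).1 inferInstance

lemma IsCompatiblePair.isHomeomorph_frameOp [CompleteSpace (V μ ω)]
    (hD : IsReflexiveTVS D) (hω : WeaklyMeasurable μ ω) (hθ : WeaklyMeasurable μ θ)
    (hω_ind : IsMuIndependent μ ω) (hθ_ind : IsMuIndependent μ θ)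
    (hω_tot : IsTotalMap μ ω) (hθ_tot : IsTotalMap μ θ) (h : IsCompatiblePair μ ω θ) :
    IsHomeomorph (frameOp h.admissible : D → ConjDual D) := by
  have hω_surj := synthesis_surjective_of_isClosed hD h.admissible hω hθ hθ_ind hω_tot
    isClosed_range_synthesis
  have := h.completeSpace_W hD hω_surj
  have hθ_surj := synthesis_surjective_of_isClosed hD h.admissible.symm hθ hω hω_ind hθ_tot
    isClosed_range_synthesis_of_quot
  obtain ⟨Z, hZ⟩ := h.conjDual
  let e : D ≃L[ℂ] ConjDual D := (bidualEquiv hD).trans <|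
    (conjDualCongr (synthesisEquiv hθ_surj)).trans <| Z.symm.trans (synthesisEquiv hω_surj)
  have he : ∀ f, e f = frameOp h.admissible f := fun f => by
    rw [← synthesis_analysis h.admissible hθ, ← synthesisEquiv_cls hω_surj]
    refine congrArg (synthesisEquiv hω_surj) (Z.symm_apply_eq.2 ?_)
    ext w
    obtain ⟨η, rfl⟩ := cls_surjective w
    rw [hZ, integral_analysis_mul_conj]
    simp
  rw [← funext he]
  exact e.toHomeomorph.isHomeomorph

end Complete

end DistributionPairs

end

theorem mainTheorem1 {X : Type*} [MeasurableSpace X] (μ : Measure X)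
    {D : Type*} [AddCommGroup D] [Module ℂ D] [UniformSpace D] [IsUniformAddGroup D]
    [ContinuousSMul ℂ D] [LocallyConvexSpace ℝ D] [T2Space D]
    [(uniformity D).IsCountablyGenerated] [CompleteSpace D]
    (hD : IsReflexiveTVS D) (ω θ : X → ConjDual D)
    (hω : WeaklyMeasurable μ ω) (hθ : WeaklyMeasurable μ θ)
    (hω_ind : IsMuIndependent μ ω) (hθ_ind : IsMuIndependent μ θ)
    (hω_tot : IsTotalMap μ ω) (hθ_tot : IsTotalMap μ θ)
    (hV : CompleteSpace (V μ ω)) :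
    IsCompatiblePair μ ω θ ↔
      ∃ h : FormAdmissible μ θ ω, IsHomeomorph (frameOp h : D → ConjDual D) :=
  ⟨fun h => ⟨h.admissible,
      h.isHomeomorph_frameOp hD hω hθ hω_ind hθ_ind hω_tot hθ_tot⟩,
    fun ⟨h, hS⟩ => isCompatiblePair_of_isHomeomorph_frameOp hD hω hθ hω_ind hθ_ind h hS⟩
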